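/- Let $(\Omega,\mu)$ be an atomless finite measure space (every measurable set of positive measure contains a measurable subset of strictly smaller positive measure). An exponent is a real measurable function on $\Omega$ with values in $[1,\infty)$; no boundedness is assumed. For an exponent $p(\cdot)$ let $L^{p(\cdot)}(\mu)$ be the space of classes of real measurable functions $f$ on $\Omega$ with $\rho_{p(\cdot)}(f/r)<\infty$ for some $r>0$, where $\rho_{p(\cdot)}(f)=\int_\Omega|f(t)|^{p(t)}\,d\mu$, with the norm $\|f\|_{p(\cdot)}=\inf\{r>0:\rho_{p(\cdot)}(f/r)\le1\}$. For a measurable $f$ let $f^*(x)=\inf\{s\ge0:\mu(\{|f|>s\})\le x\}$, $0<x<\mu(\Omega)$, be its decreasing rearrangement. Let $p(\cdot),q(\cdot)$ be exponents with $q(\cdot)<p(\cdot)$ $\mu$-a.e., and let $i:L^{p(\cdot)}(\mu)\hookrightarrow L^{q(\cdot)}(\mu)$ be the (bounded) inclusion. The following are equivalent: 1. $\displaystyle\int_0^{\mu(\Omega)}a^{\left(\frac{pq}{p-q}\right)^*(x)}\,dx<\infty$ for every $a>1$. 2. $i$ is L-weakly compact: $\displaystyle\lim_{n\to\infty}\sup_{\|f\|_{p(\cdot)}\le1}\|f\chi_{A_n}\|_{q(\cdot)}=0$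 for every sequence $(A_n)$ of measurable sets with $\chi_{A_n}\to0$ $\mu$-a.e. 3. $i$ is M-weakly compact: $\|f_n\|_{q(\cdot)}\to0$ for every norm bounded sequence $(f_n)$ of pairwise disjoint functions in $L^{p(\cdot)}(\mu)$. 4. $i$ is disjointly strictly singular (DSS): for no normalized sequence $(f_n)$ of pairwise disjoint functions in $L^{p(\cdot)}(\mu)$ is the restriction of $i$ to the closed linear span $[f_n]$ in $L^{p(\cdot)}(\mu)$ an isomorphism onto its image. 5. For no sequence $(E_n)$ of pairwise disjoint measurable sets of positive measure is the restriction of $i$ to the closed linear span in $L^{p(\cdot)}(\mu)$ of the functions $\dfrac{\chi_{E_n}}{\mu(E_n)^{1/p(\cdot)}}$ an isomorphism onto its image. 6. $\displaystyle\lim_{x\to\mu(\Omega)^-}(\mu(\Omega)-x)^{\left(\frac{p-q}{pq}\right)^*(x)}=0$. -/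

import Mathlib

open MeasureTheory Filter Topology
open scoped ENNReal

noncomputable section

/-- A measure is atomless if every measurable set of positive measure contains a measurable subset
of strictly smaller positive measure. (Mathlib's `NoAtoms` only says that points are null.) -/
def IsAtomless {Ω : Type*} [MeasurableSpace Ω] (μ : Measure Ω) : Prop :=
  ∀ A : Set Ω, MeasurableSet A → 0 < μ A →
    ∃ B : Set Ω, B ⊆ A ∧ MeasurableSet B ∧ 0 < μ B ∧ μ B < μ A

/-- An exponent: a measurable function `p : Ω → [1, ∞)`, possibly unbounded. -/
structure Exponent (Ω : Type*) [MeasurableSpace Ω] where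
  toFun : Ω → ℝ
  measurable' : Measurable toFun
  one_le' : ∀ t, 1 ≤ toFun t

instance {Ω : Type*} [MeasurableSpace Ω] : CoeFun (Exponent Ω) (fun _ => Ω → ℝ) :=
  ⟨Exponent.toFun⟩

/-- The modular `ρ_p(f) = ∫ |f(t)|^{p(t)} dμ ∈ [0, ∞]`. -/
def modular {Ω : Type*} [MeasurableSpace Ω] (μ : Measure Ω) (p : Exponent Ω) (f : Ω → ℝ) : ℝ≥0∞ :=
  ∫⁻ t, ENNReal.ofReal (|f t| ^ p t) ∂μ

/-- The Luxemburg norm `inf {r > 0 : ρ_p(f / r) ≤ 1}`. -/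
def luxNorm {Ω : Type*} [MeasurableSpace Ω] (μ : Measure Ω) (p : Exponent Ω) (f : Ω → ℝ) : ℝ :=
  sInf {r : ℝ | 0 < r ∧ modular μ p (fun t => f t / r) ≤ 1}

section Modular

variable {Ω : Type*} [MeasurableSpace Ω] {μ : Measure Ω} {p : Exponent Ω}

lemma modular_congr {f g : Ω → ℝ} (h : f =ᵐ[μ] g) : modular μ p f = modular μ p g := by
  refine lintegral_congr_ae ?_
  filter_upwards [h] with t ht
  rw [ht]

lemma modular_mono {f g : Ω → ℝ} (h : ∀ᵐ t ∂μ, |f t| ≤ |g t|) : modular μ p f ≤ modular μ p g := by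
  refine lintegral_mono_ae ?_
  filter_upwards [h] with t ht
  have := p.one_le' t
  exact ENNReal.ofReal_le_ofReal (Real.rpow_le_rpow (abs_nonneg _) ht (by linarith))

lemma modular_zero : modular μ p (fun _ => 0) = 0 := by
  have h : ∀ t, (|(0 : ℝ)|) ^ p t = 0 := fun t => by
    have := p.one_le' t
    rw [abs_zero, Real.zero_rpow (by linarith)]
  simp only [modular, h, ENNReal.ofReal_zero, lintegral_zero]

lemma modular_smul_le {f : Ω → ℝ} {c : ℝ} (hc : 0 ≤ c) (hc1 : c ≤ 1) :
    modular μ p (fun t => c * f t) ≤ ENNReal.ofReal c * modular μ p f := by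
  unfold modular
  rw [← lintegral_const_mul' _ _ ENNReal.ofReal_ne_top]
  refine lintegral_mono fun t => ?_
  have hp := p.one_le' t
  rw [← ENNReal.ofReal_mul hc]
  refine ENNReal.ofReal_le_ofReal ?_
  rw [abs_mul, abs_of_nonneg hc, Real.mul_rpow hc (abs_nonneg _)]
  refine mul_le_mul_of_nonneg_right ?_ (by positivity)
  rcases hc.eq_or_lt with rfl | h0
  · rw [Real.zero_rpow (by linarith)]
  · calc c ^ p t ≤ c ^ (1 : ℝ) := Real.rpow_le_rpow_of_exponent_ge h0 hc1 hp
      _ = c := Real.rpow_one c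

lemma measurable_modular_integrand {f : Ω → ℝ} (hf : AEStronglyMeasurable f μ) :
    AEMeasurable (fun t => ENNReal.ofReal (|f t| ^ p t)) μ := by
  have h1 : AEMeasurable (fun t => |f t|) μ := hf.norm.aemeasurable
  exact (h1.pow p.measurable'.aemeasurable).ennreal_ofReal

lemma modular_convex {f g : Ω → ℝ} (hf : AEStronglyMeasurable f μ) {a b : ℝ} (ha : 0 ≤ a)
    (hb : 0 ≤ b) (hab : a + b = 1) :
    modular μ p (fun t => a * f t + b * g t) ≤
      ENNReal.ofReal a * modular μ p f + ENNReal.ofReal b * modular μ p g := by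
  unfold modular
  rw [← lintegral_const_mul' _ _ ENNReal.ofReal_ne_top,
    ← lintegral_const_mul' _ _ ENNReal.ofReal_ne_top,
    ← lintegral_add_left' ((measurable_modular_integrand hf).const_mul _)]
  refine lintegral_mono fun t => ?_
  have hp := p.one_le' t
  rw [← ENNReal.ofReal_mul ha, ← ENNReal.ofReal_mul hb,
    ← ENNReal.ofReal_add (by positivity) (by positivity)]
  refine ENNReal.ofReal_le_ofReal ?_
  have h1 : |a * f t + b * g t| ≤ a * |f t| + b * |g t| := by
    calc |a * f t + b * g t| ≤ |a * f t| + |b * g t| := abs_add_le _ _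
      _ = a * |f t| + b * |g t| := by rw [abs_mul, abs_mul, abs_of_nonneg ha, abs_of_nonneg hb]
  have h2 := (convexOn_rpow hp).2 (abs_nonneg (f t)) (abs_nonneg (g t)) ha hb hab
  simp only [smul_eq_mul] at h2
  exact (Real.rpow_le_rpow (abs_nonneg _) h1 (by linarith)).trans h2

lemma exists_modular_le_one {f : Ω → ℝ} {r : ℝ} (hr : 0 < r)
    (h : modular μ p (fun t => f t / r) < ∞) :
    ∃ s : ℝ, 0 < s ∧ modular μ p (fun t => f t / s) ≤ 1 := by
  set M : ℝ := (modular μ p (fun t => f t / r)).toReal with hM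
  have hM0 : 0 ≤ M := ENNReal.toReal_nonneg
  refine ⟨r * (M + 1), by positivity, ?_⟩
  have hc : (M + 1)⁻¹ ≤ 1 := inv_le_one_of_one_le₀ (by linarith)
  have key := modular_smul_le (μ := μ) (p := p) (f := fun t => f t / r) (c := (M + 1)⁻¹)
    (by positivity) hc
  have e : (fun t => f t / (r * (M + 1))) = fun t => (M + 1)⁻¹ * (f t / r) := by
    funext t
    field_simp
  rw [e]
  refine key.trans ?_
  rw [← ENNReal.ofReal_toReal h.ne, ← hM, ← ENNReal.ofReal_mul (by positivity)]
  rw [← ENNReal.ofReal_one]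
  refine ENNReal.ofReal_le_ofReal ?_
  rw [inv_mul_le_iff₀ (by positivity)]
  linarith

lemma modular_add_le_one {f g : Ω → ℝ} (hf : AEStronglyMeasurable f μ) {r s : ℝ} (hr : 0 < r)
    (hs : 0 < s) (h1 : modular μ p (fun t => f t / r) ≤ 1)
    (h2 : modular μ p (fun t => g t / s) ≤ 1) :
    modular μ p (fun t => (f t + g t) / (r + s)) ≤ 1 := by
  have hrs : 0 < r + s := by positivity
  have e : (fun t => (f t + g t) / (r + s)) =
      fun t => r / (r + s) * (f t / r) + s / (r + s) * (g t / s) := by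
    funext t
    field_simp
  have hab : r / (r + s) + s / (r + s) = 1 := by field_simp
  rw [e]
  refine (modular_convex (f := fun t => f t / r) (g := fun t => g t / s)
    (by simpa only [div_eq_inv_mul] using hf.const_mul r⁻¹) (by positivity)
    (by positivity) hab).trans ?_
  calc _ ≤ ENNReal.ofReal (r / (r + s)) * 1 + ENNReal.ofReal (s / (r + s)) * 1 := by gcongr
    _ = 1 := by
      rw [mul_one, mul_one, ← ENNReal.ofReal_add (by positivity) (by positivity), hab,
        ENNReal.ofReal_one]

lemma luxNorm_congr {f g : Ω → ℝ} (h : f =ᵐ[μ] g) : luxNorm μ p f = luxNorm μ p g := by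
  have : ∀ r : ℝ, modular μ p (fun t => f t / r) = modular μ p (fun t => g t / r) := fun r =>
    modular_congr (by filter_upwards [h] with t ht; rw [ht])
  simp only [luxNorm, this]

lemma luxNorm_nonneg (f : Ω → ℝ) : 0 ≤ luxNorm μ p f :=
  Real.sInf_nonneg fun _ hr => hr.1.le

lemma luxNorm_le {f : Ω → ℝ} {r : ℝ} (hr : 0 < r) (h : modular μ p (fun t => f t / r) ≤ 1) :
    luxNorm μ p f ≤ r :=
  csInf_le ⟨0, fun _ hs => hs.1.le⟩ ⟨hr, h⟩

lemma modular_le_one_of_luxNorm_lt {f : Ω → ℝ} (h0 : ∃ s : ℝ, 0 < s ∧ modular μ p (fun t => f t / s) ≤ 1)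
    {r : ℝ} (h : luxNorm μ p f < r) : 0 < r ∧ modular μ p (fun t => f t / r) ≤ 1 := by
  obtain ⟨s, ⟨hs, hs1⟩, hsr⟩ := exists_lt_of_csInf_lt (s := {r : ℝ | 0 < r ∧
    modular μ p (fun t => f t / r) ≤ 1}) h0 h
  have hr : 0 < r := hs.trans hsr
  refine ⟨hr, (modular_mono (.of_forall fun t => ?_)).trans hs1⟩
  rw [abs_div, abs_div, abs_of_pos hs, abs_of_pos hr]
  gcongr

end Modular

/-- The variable Lebesgue space `L^{p(·)}(μ)`: the classes of real measurable functions `f` with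
`ρ_p(f / r) < ∞` for some `r > 0`. -/
def VarLp {Ω : Type*} [MeasurableSpace Ω] (μ : Measure Ω) (p : Exponent Ω) :
    Submodule ℝ (Ω →ₘ[μ] ℝ) where
  carrier := {f | ∃ r : ℝ, 0 < r ∧ modular μ p (fun t => f t / r) < ∞}
  zero_mem' := by
    refine ⟨1, one_pos, ?_⟩
    have h : (fun t => (0 : Ω →ₘ[μ] ℝ) t / 1) =ᵐ[μ] fun _ => 0 := by
      filter_upwards [AEEqFun.coeFn_zero (α := Ω) (β := ℝ) (μ := μ)] with t ht
      rw [ht]; simp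
    rw [modular_congr h, modular_zero]
    exact ENNReal.zero_lt_top
  add_mem' := by
    rintro f g ⟨r, hr, h1⟩ ⟨s, hs, h2⟩
    obtain ⟨r', hr', h1'⟩ := exists_modular_le_one hr h1
    obtain ⟨s', hs', h2'⟩ := exists_modular_le_one hs h2
    refine ⟨r' + s', by positivity, ?_⟩
    have h : (fun t => (f + g) t / (r' + s')) =ᵐ[μ] fun t => (f t + g t) / (r' + s') := by
      filter_upwards [AEEqFun.coeFn_add f g] with t ht
      rw [ht]; rfl
    rw [modular_congr h]
    exact (modular_add_le_one f.aestronglyMeasurable hr' hs' h1' h2').trans_lt ENNReal.one_lt_top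
  smul_mem' := by
    rintro c f ⟨r, hr, h1⟩
    refine ⟨(|c| + 1) * r, by positivity, lt_of_le_of_lt (modular_mono ?_) h1⟩
    filter_upwards [AEEqFun.coeFn_smul c f] with t ht
    rw [ht, Pi.smul_apply, smul_eq_mul, abs_div, abs_div, abs_mul, abs_of_pos hr,
      abs_of_pos (show 0 < (|c| + 1) * r by positivity), div_le_div_iff₀ (by positivity) hr]
    have := abs_nonneg c
    have := abs_nonneg (f t)
    nlinarith [mul_nonneg this hr.le]

namespace VarLp

variable {Ω : Type*} [MeasurableSpace Ω] {μ : Measure Ω} {p q : Exponent Ω}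

instance : CoeFun (VarLp μ p) (fun _ => Ω → ℝ) := ⟨fun f => ((f : Ω →ₘ[μ] ℝ) : Ω → ℝ)⟩

instance : Norm (VarLp μ p) := ⟨fun f => luxNorm μ p f⟩

lemma norm_def (f : VarLp μ p) : ‖f‖ = luxNorm μ p f := rfl

lemma exists_le_one (f : VarLp μ p) : ∃ s : ℝ, 0 < s ∧ modular μ p (fun t => f t / s) ≤ 1 := by
  obtain ⟨r, hr, h⟩ := f.2
  exact exists_modular_le_one hr h

lemma norm_smul_le' (c : ℝ) (f : VarLp μ p) : ‖c • f‖ ≤ |c| * ‖f‖ := by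
  have hcf : (c • f : VarLp μ p) =ᵐ[μ] fun t => c * f t := AEEqFun.coeFn_smul c (f : Ω →ₘ[μ] ℝ)
  refine le_of_forall_pos_le_add fun ε hε => ?_
  rw [norm_def, luxNorm_congr hcf]
  have hd : 0 < ε / (|c| + 1) := by positivity
  obtain ⟨h0, h1⟩ := modular_le_one_of_luxNorm_lt (exists_le_one f)
    (show luxNorm μ p f < ‖f‖ + ε / (|c| + 1) by rw [norm_def]; linarith)
  have hn : 0 ≤ ‖f‖ := luxNorm_nonneg _
  have hs : 0 < |c| * ‖f‖ + ε := by positivity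
  refine luxNorm_le hs ((modular_mono (.of_forall fun t => ?_)).trans h1)
  rw [abs_div, abs_div, abs_mul, abs_of_pos h0, abs_of_pos hs, div_le_div_iff₀ hs h0]
  have h3 : |c| * (‖f‖ + ε / (|c| + 1)) ≤ |c| * ‖f‖ + ε := by
    have : |c| * (ε / (|c| + 1)) ≤ ε := by
      rw [mul_div_assoc', div_le_iff₀ (by positivity)]
      nlinarith [abs_nonneg c]
    linarith
  calc |c| * |f t| * (‖f‖ + ε / (|c| + 1)) = |f t| * (|c| * (‖f‖ + ε / (|c| + 1))) := by ring
    _ ≤ |f t| * (|c| * ‖f‖ + ε) := by gcongr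

lemma norm_add_le' (f g : VarLp μ p) : ‖f + g‖ ≤ ‖f‖ + ‖g‖ := by
  have hfg : (f + g : VarLp μ p) =ᵐ[μ] fun t => f t + g t :=
    AEEqFun.coeFn_add (f : Ω →ₘ[μ] ℝ) (g : Ω →ₘ[μ] ℝ)
  refine le_of_forall_pos_le_add fun ε hε => ?_
  rw [norm_def, luxNorm_congr hfg]
  obtain ⟨h0, h1⟩ := modular_le_one_of_luxNorm_lt (exists_le_one f)
    (show luxNorm μ p f < ‖f‖ + ε / 2 by rw [norm_def]; linarith)
  obtain ⟨h2, h3⟩ := modular_le_one_of_luxNorm_lt (exists_le_one g)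
    (show luxNorm μ p g < ‖g‖ + ε / 2 by rw [norm_def]; linarith)
  have := luxNorm_le (by positivity)
    (modular_add_le_one (AEEqFun.aestronglyMeasurable (f : Ω →ₘ[μ] ℝ)) h0 h2 h1 h3)
  linarith

lemma eq_zero_of_norm_eq_zero {f : VarLp μ p} (h : ‖f‖ = 0) : f = 0 := by
  have key : ∀ ε : ℝ, 0 < ε → ε ≤ 1 → modular μ p f ≤ ENNReal.ofReal ε := by
    intro ε hε hε1
    have h1 := (modular_le_one_of_luxNorm_lt (exists_le_one f)
      (show luxNorm μ p f < ε by rw [← norm_def, h]; exact hε)).2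
    have h2 := modular_smul_le (μ := μ) (p := p) (f := fun t => f t / ε) hε.le hε1
    have e : (fun t => ε * (f t / ε)) = f := by
      funext t
      field_simp
    rw [e] at h2
    exact h2.trans ((mul_le_mul_right h1 _).trans (mul_one _).le)
  have h0 : modular μ p f = 0 := by
    by_contra hne
    obtain ⟨ε, hε, hlt⟩ := ENNReal.lt_iff_exists_nnreal_btwn.1 (pos_iff_ne_zero.2 hne)
    have hε' : (0 : ℝ) < ε := by exact_mod_cast hε
    have h3 := key (min ε 1) (lt_min hε' one_pos) (min_le_right _ _)
    have h4 : ENNReal.ofReal (min (ε : ℝ) 1) ≤ ε := by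
      rw [← ENNReal.ofReal_coe_nnreal]
      exact ENNReal.ofReal_le_ofReal (min_le_left _ _)
    exact absurd (h3.trans h4) (not_le.2 hlt)
  have h5 := (lintegral_eq_zero_iff' (measurable_modular_integrand
    (AEEqFun.aestronglyMeasurable (f : Ω →ₘ[μ] ℝ)))).1 h0
  apply Subtype.ext
  refine AEEqFun.ext ?_
  filter_upwards [h5, AEEqFun.coeFn_zero (α := Ω) (β := ℝ) (μ := μ)] with t ht ht0
  have hp := p.one_le' t
  have h6 : |f t| ^ p t ≤ 0 := ENNReal.ofReal_eq_zero.1 ht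
  have h7 : |f t| ^ p t = 0 := le_antisymm h6 (by positivity)
  have h8 := (Real.rpow_eq_zero (abs_nonneg _) (by linarith)).1 h7
  rw [abs_eq_zero.1 h8]
  exact ht0.symm

lemma norm_zero' : ‖(0 : VarLp μ p)‖ = 0 :=
  le_antisymm (by simpa using norm_smul_le' (0 : ℝ) (0 : VarLp μ p)) (luxNorm_nonneg _)

lemma core : NormedSpace.Core ℝ (VarLp μ p) where
  norm_nonneg f := luxNorm_nonneg _
  norm_smul c f := by
    refine le_antisymm (norm_smul_le' c f) ?_
    rcases eq_or_ne c 0 with rfl | hc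
    · rw [norm_zero, zero_mul]
      exact luxNorm_nonneg _
    · have h := norm_smul_le' c⁻¹ (c • f)
      rw [inv_smul_smul₀ hc, abs_inv] at h
      have hc' : 0 < |c| := abs_pos.2 hc
      rw [Real.norm_eq_abs]
      rwa [← div_eq_inv_mul, le_div_iff₀ hc', mul_comm] at h
  norm_triangle := norm_add_le'
  norm_eq_zero_iff f := ⟨eq_zero_of_norm_eq_zero, fun h => h ▸ norm_zero'⟩

/-- The Luxemburg norm makes `L^{p(·)}(μ)` a normed space. -/
instance : NormedAddCommGroup (VarLp μ p) := NormedAddCommGroup.ofCore core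

instance : NormedSpace ℝ (VarLp μ p) := NormedSpace.ofCore core

lemma modular_le_of_le [IsFiniteMeasure μ] (h : ∀ᵐ t ∂μ, q t ≤ p t) (f : Ω → ℝ) :
    modular μ q f ≤ μ Set.univ + modular μ p f := by
  have e : μ Set.univ = ∫⁻ _, 1 ∂μ := by simp
  rw [e, modular, modular, ← lintegral_add_left measurable_const]
  refine lintegral_mono_ae ?_
  filter_upwards [h] with t ht
  have hq := q.one_le' t
  rw [← ENNReal.ofReal_one, ← ENNReal.ofReal_add zero_le_one (by positivity)]
  refine ENNReal.ofReal_le_ofReal ?_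
  rcases le_total |f t| 1 with h1 | h1
  · have h2 := Real.rpow_le_one (abs_nonneg (f t)) h1 (show 0 ≤ q t by linarith)
    have h3 : 0 ≤ |f t| ^ p t := by positivity
    linarith
  · have := Real.rpow_le_rpow_of_exponent_le h1 ht
    linarith

lemma modular_div_le_one [IsFiniteMeasure μ] (h : ∀ᵐ t ∂μ, q t ≤ p t) {f : Ω → ℝ} {r : ℝ}
    (h1 : modular μ p (fun t => f t / r) ≤ 1) :
    modular μ q (fun t => f t / ((μ.real Set.univ + 1) * r)) ≤ 1 := by
  set M := μ.real Set.univ with hM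
  have hM0 : 0 ≤ M := measureReal_nonneg
  have e : (fun t => f t / ((M + 1) * r)) = fun t => (M + 1)⁻¹ * (f t / r) := by
    funext t
    rw [mul_comm (M + 1) r, ← div_div, div_eq_inv_mul]
  rw [e]
  refine (modular_smul_le (by positivity) (inv_le_one_of_one_le₀ (by linarith))).trans ?_
  have h2 := (modular_le_of_le h (fun t => f t / r)).trans (add_le_add_right h1 _)
  calc _ ≤ ENNReal.ofReal (M + 1)⁻¹ * (μ Set.univ + 1) := by gcongr
    _ = ENNReal.ofReal (M + 1)⁻¹ * ENNReal.ofReal (M + 1) := by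
      rw [ENNReal.ofReal_add hM0 zero_le_one, ENNReal.ofReal_one, hM, ofReal_measureReal]
    _ = 1 := by
      rw [← ENNReal.ofReal_mul (by positivity), inv_mul_cancel₀ (by positivity),
        ENNReal.ofReal_one]

lemma le_of_exponent_le [IsFiniteMeasure μ] (h : ∀ᵐ t ∂μ, q t ≤ p t) : VarLp μ p ≤ VarLp μ q := by
  rintro f ⟨r, hr, hf⟩
  obtain ⟨s, hs, h1⟩ := exists_modular_le_one hr hf
  have : 0 ≤ μ.real Set.univ := measureReal_nonneg
  exact ⟨_, by positivity, (modular_div_le_one h h1).trans_lt ENNReal.one_lt_top⟩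

/-- The inclusion `L^{p(·)}(μ) ↪ L^{q(·)}(μ)`, `f ↦ f`, for `q ≤ p` a.e. and `μ` finite, as a
continuous linear operator. -/
def inclusion [IsFiniteMeasure μ] (h : ∀ᵐ t ∂μ, q t ≤ p t) : VarLp μ p →L[ℝ] VarLp μ q :=
  (Submodule.inclusion (le_of_exponent_le h)).mkContinuous (μ.real Set.univ + 1) fun f => by
    have hM : 0 ≤ μ.real Set.univ := measureReal_nonneg
    refine le_of_forall_pos_le_add fun ε hε => ?_
    have hd : 0 < ε / (μ.real Set.univ + 1) := by positivity
    obtain ⟨h0, h1⟩ := modular_le_one_of_luxNorm_lt (exists_le_one f)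
      (show luxNorm μ p f < ‖f‖ + ε / (μ.real Set.univ + 1) by rw [norm_def]; linarith)
    refine (luxNorm_le (by positivity) (modular_div_le_one h h1)).trans_eq ?_
    field_simp

/-- The element `χ_E / μ(E)^{1/p(·)}` of `L^{p(·)}(μ)`, for `E` measurable and `μ` finite. -/
def normalizedIndicator [IsFiniteMeasure μ] (p : Exponent Ω) (E : Set Ω) (hE : MeasurableSet E) :
    VarLp μ p :=
  ⟨AEEqFun.mk (E.indicator fun t => 1 / μ.real E ^ (1 / p t))
      ((Measurable.indicator (measurable_const.div
        (measurable_const.pow (measurable_const.div p.measurable'))) hE).aestronglyMeasurable), by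
    refine ⟨1, one_pos, ?_⟩
    have h : (fun t => (AEEqFun.mk (E.indicator fun t => 1 / μ.real E ^ (1 / p t))
      ((Measurable.indicator (measurable_const.div (measurable_const.pow
        (measurable_const.div p.measurable'))) hE).aestronglyMeasurable) : Ω →ₘ[μ] ℝ) t / 1)
        =ᵐ[μ] E.indicator fun t => 1 / μ.real E ^ (1 / p t) := by
      filter_upwards [AEEqFun.coeFn_mk (μ := μ) (E.indicator fun t => 1 / μ.real E ^ (1 / p t))
        ((Measurable.indicator (measurable_const.div (measurable_const.pow
        (measurable_const.div p.measurable'))) hE).aestronglyMeasurable)] with t ht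
      rw [ht, div_one]
    rw [modular_congr h]
    have hb : modular μ p (E.indicator fun t => 1 / μ.real E ^ (1 / p t)) ≤
        ∫⁻ _, ENNReal.ofReal (μ.real E)⁻¹ ∂μ := by
      refine lintegral_mono fun t => ENNReal.ofReal_le_ofReal ?_
      have hp := p.one_le' t
      have hE0 : 0 ≤ μ.real E := measureReal_nonneg
      by_cases ht : t ∈ E
      · rw [Set.indicator_of_mem ht, abs_of_nonneg (by positivity), one_div,
          Real.inv_rpow (by positivity), ← Real.rpow_mul hE0,
          one_div_mul_cancel (by linarith), Real.rpow_one]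
      · rw [Set.indicator_of_notMem ht, abs_zero, Real.zero_rpow (by linarith)]
        positivity
    refine hb.trans_lt ?_
    rw [lintegral_const]
    exact ENNReal.mul_lt_top ENNReal.ofReal_lt_top (measure_lt_top μ _)⟩

/-- A sequence in `L^{p(·)}(μ)` is disjoint if `|f_m| ∧ |f_n| = 0` a.e. for `m ≠ n`. -/
def IsDisjointSeq (f : ℕ → VarLp μ p) : Prop :=
  Pairwise fun m n => ∀ᵐ t ∂μ, f m t = 0 ∨ f n t = 0

/-- `T : L^{p(·)}(μ) → L^{q(·)}(μ)` is L-weakly compact (almost compact) if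
`sup {‖T(f) χ_{A_n}‖ : ‖f‖ ≤ 1} → 0` whenever the `A_n` are measurable and `χ_{A_n} → 0` a.e. -/
def IsLWeaklyCompact (T : VarLp μ p →L[ℝ] VarLp μ q) : Prop :=
  ∀ A : ℕ → Set Ω, (∀ n, MeasurableSet (A n)) →
    (∀ᵐ t ∂μ, Tendsto (fun n => (A n).indicator (fun _ => (1 : ℝ)) t) atTop (𝓝 0)) →
    Tendsto (fun n => ⨆ f ∈ {f : VarLp μ p | ‖f‖ ≤ 1},
      ENNReal.ofReal (luxNorm μ q ((A n).indicator (T f)))) atTop (𝓝 0)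

variable {F : Type*} [NormedAddCommGroup F] [NormedSpace ℝ F]

/-- `T` is M-weakly compact if `‖T f_n‖ → 0` for every norm bounded disjoint sequence. -/
def IsMWeaklyCompact (T : VarLp μ p →L[ℝ] F) : Prop :=
  ∀ f : ℕ → VarLp μ p, (∃ C : ℝ, ∀ n, ‖f n‖ ≤ C) → IsDisjointSeq f →
    Tendsto (fun n => ‖T (f n)‖) atTop (𝓝 0)

/-- The closed linear span `[f_n]` of a sequence. -/
def closedSpan (f : ℕ → VarLp μ p) : Submodule ℝ (VarLp μ p) :=
  (Submodule.span ℝ (Set.range f)).topologicalClosure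

/-- The restriction of the bounded operator `T` to the subspace `S` is an isomorphism (onto its
image), i.e. `T` is bounded below on `S`. -/
def IsIsomorphismOn (T : VarLp μ p →L[ℝ] F) (S : Submodule ℝ (VarLp μ p)) : Prop :=
  ∃ c : ℝ, 0 < c ∧ ∀ f ∈ S, c * ‖f‖ ≤ ‖T f‖

/-- `T` is disjointly strictly singular: it is not an isomorphism on the closed span of any
normalized disjoint sequence. -/
def IsDSS (T : VarLp μ p →L[ℝ] F) : Prop :=
  ∀ f : ℕ → VarLp μ p, (∀ n, ‖f n‖ = 1) → IsDisjointSeq f → ¬ IsIsomorphismOn T (closedSpan f)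

end VarLp

/-- The decreasing rearrangement `f^*(x) = inf {s ≥ 0 : μ {|f| > s} ≤ x}`. For `μ` finite and
`x > 0` the set is nonempty, so that the real infimum is the true one. -/
def rearrangement {Ω : Type*} [MeasurableSpace Ω] (μ : Measure Ω) (f : Ω → ℝ) (x : ℝ) : ℝ :=
  sInf {s : ℝ | 0 ≤ s ∧ μ {t | s < |f t|} ≤ ENNReal.ofReal x}

end

/-! Everything is governed by the distribution of the gap function g = pq/(p-q), for which 1/q - 1/p
= 1/g. Conditions 1 and 6 are two forms of one tail condition (`HasSuperexponentialTail`): for every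
C > 0, μ{g ≥ u} < e^{-Cu} for all large u. For 1, equimeasurability turns the integral into ∫ a^g
dμ, and Markov's inequality together with a slicing into integer levels compares it with the tail.
For 6, the exponent is the rearrangement of 1/g, and the substitution μ(Ω) - x = e^{-Cu} turns the
limit into the tail condition.

The step from 1 to 2 rests on the pointwise inequality (xy)^q ≤ x^p + y^g
(`Real.mul_rpow_le_rpow_add_rpow`): it bounds the q-modular of fχ_A/ε by 1/2 + ∫_A a^g dμ, uniformly
over the unit ball, and dominated convergence applies. The implications 2 → 3 → 4 → 5 are formal.

From 5 back to the tail condition one argues by contraposition. If it fails, there are disjoint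
bands E_n of g with μ(E_n) ≥ K^{-g} on E_n. Then μ(E_n)^{1/q - 1/p} ≥ 1/K there, so the p- and
q-normalized indicators of E_n are comparable up to K, and the two norms are equivalent on the
closed span. -/

section Rearrangement

/-! ### Decreasing rearrangements and equimeasurability. -/

variable {Ω : Type*} [MeasurableSpace Ω] {μ : Measure Ω} {f g : Ω → ℝ}

lemma rearrangement_nonneg (f : Ω → ℝ) (x : ℝ) : 0 ≤ rearrangement μ f x :=
  Real.sInf_nonneg fun _ hs => hs.1

/-- Finiteness of μ forces μ{|f| > n} → 0. This rules out the junk value `sInf ∅ = 0` and is where x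
> 0 matters. -/
lemma rearrangement_set_nonempty [IsFiniteMeasure μ] (hf : Measurable f) {x : ℝ} (hx : 0 < x) :
    {s : ℝ | 0 ≤ s ∧ μ {t | s < |f t|} ≤ ENNReal.ofReal x}.Nonempty := by
  have h : Tendsto (fun n : ℕ => μ {t | (n : ℝ) < |f t|}) atTop
      (𝓝 (μ (⋂ n : ℕ, {t | (n : ℝ) < |f t|}))) := by
    refine tendsto_measure_iInter_atTop
      (fun n => (measurableSet_lt measurable_const hf.abs).nullMeasurableSet) ?_
      ⟨0, measure_ne_top _ _⟩
    intro m n hmn t ht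
    simp only [Set.mem_ofPred_eq] at ht ⊢
    exact lt_of_le_of_lt (Nat.cast_le.2 hmn) ht
  have h0 : (⋂ n : ℕ, {t | (n : ℝ) < |f t|}) = ∅ := by
    ext t
    simp only [Set.mem_iInter, Set.mem_ofPred_eq, Set.mem_empty_iff_false, iff_false, not_forall,
      not_lt]
    exact exists_nat_ge _
  rw [h0, measure_empty] at h
  obtain ⟨n, hn⟩ := (h.eventually (gt_mem_nhds (ENNReal.ofReal_pos.2 hx))).exists
  exact ⟨n, Nat.cast_nonneg n, hn.le⟩

/-- The distribution function s ↦ μ{|f| > s} is right continuous, by continuity of μ from below, so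
the infimum defining f^* is attained. -/
lemma lt_rearrangement_iff [IsFiniteMeasure μ] (hf : Measurable f) {x s : ℝ} (hx : 0 < x)
    (hs : 0 ≤ s) : s < rearrangement μ f x ↔ ENNReal.ofReal x < μ {t | s < |f t|} := by
  rw [← not_le, ← not_le, not_iff_not]
  constructor
  · intro h
    have hU : {t | s < |f t|} = ⋃ n : ℕ, {t | s + 1 / ((n : ℝ) + 1) < |f t|} := by
      ext t
      simp only [Set.mem_ofPred_eq, Set.mem_iUnion]
      constructor
      · intro ht
        obtain ⟨n, hn⟩ := exists_nat_one_div_lt (sub_pos.2 ht)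
        exact ⟨n, by linarith⟩
      · rintro ⟨n, hn⟩
        have : 0 < 1 / ((n : ℝ) + 1) := Nat.one_div_pos_of_nat
        linarith
    have hmono : Monotone fun n : ℕ => {t | s + 1 / ((n : ℝ) + 1) < |f t|} := by
      intro m n hmn t ht
      have : 1 / ((n : ℝ) + 1) ≤ 1 / ((m : ℝ) + 1) := Nat.one_div_le_one_div hmn
      simp only [Set.mem_ofPred_eq] at ht ⊢
      linarith
    rw [hU, hmono.measure_iUnion]
    refine iSup_le fun n => ?_
    have hlt : rearrangement μ f x < s + 1 / ((n : ℝ) + 1) :=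
      lt_of_le_of_lt h (lt_add_of_pos_right _ Nat.one_div_pos_of_nat)
    obtain ⟨r, ⟨_, hr⟩, hrs⟩ := exists_lt_of_csInf_lt (rearrangement_set_nonempty hf hx) hlt
    exact (measure_mono fun t ht => hrs.trans ht).trans hr
  · intro h
    exact csInf_le ⟨0, fun _ hr => hr.1⟩ ⟨hs, h⟩

lemma antitoneOn_rearrangement [IsFiniteMeasure μ] (hf : Measurable f) :
    AntitoneOn (rearrangement μ f) (Set.Ioi 0) := by
  intro x hx y _ hxy
  refine csInf_le_csInf ⟨0, fun _ hr => hr.1⟩ (rearrangement_set_nonempty hf hx) ?_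
  exact fun s hs => ⟨hs.1, hs.2.trans (ENNReal.ofReal_le_ofReal hxy)⟩

/-- For s ≥ 0 the set {f^* > s} in (0, μ(Ω)) is exactly the interval (0, μ{|f| > s}). The two image
measures thus agree on open upper rays, and complements give the lower rays that determine a finite
measure. -/
lemma map_rearrangement [IsFiniteMeasure μ] (hf : Measurable f) :
    (volume.restrict (Set.Ioo 0 (μ.real Set.univ))).map (rearrangement μ f) =
      μ.map fun t => |f t| := by
  have hm : AEMeasurable (rearrangement μ f) (volume.restrict (Set.Ioo 0 (μ.real Set.univ))) :=
    aemeasurable_restrict_of_antitoneOn measurableSet_Ioo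
      ((antitoneOn_rearrangement hf).mono fun x hx => hx.1)
  have huniv : volume (Set.Ioo 0 (μ.real Set.univ)) = μ Set.univ := by
    rw [Real.volume_Ioo, sub_zero, ofReal_measureReal]
  have hIoi : ∀ s : ℝ, (volume.restrict (Set.Ioo 0 (μ.real Set.univ))).map (rearrangement μ f)
      (Set.Ioi s) = μ.map (fun t => |f t|) (Set.Ioi s) := by
    intro s
    rw [Measure.map_apply_of_aemeasurable hm measurableSet_Ioi,
      Measure.map_apply hf.abs measurableSet_Ioi,
      Measure.restrict_apply' measurableSet_Ioo]
    rcases lt_or_ge s 0 with hs | hs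
    · have h1 : rearrangement μ f ⁻¹' Set.Ioi s = Set.univ :=
        Set.eq_univ_of_forall fun x => hs.trans_le (rearrangement_nonneg f x)
      have h2 : (fun t => |f t|) ⁻¹' Set.Ioi s = Set.univ :=
        Set.eq_univ_of_forall fun t => hs.trans_le (abs_nonneg (f t))
      rw [h1, h2, Set.univ_inter, huniv]
    · have h1 : rearrangement μ f ⁻¹' Set.Ioi s ∩ Set.Ioo 0 (μ.real Set.univ) =
          Set.Ioo 0 (μ.real {t | s < |f t|}) := by
        ext x
        have hle : μ.real {t | s < |f t|} ≤ μ.real Set.univ := measureReal_mono (Set.subset_univ _)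
        simp only [Set.mem_inter_iff, Set.mem_preimage, Set.mem_Ioi, Set.mem_Ioo]
        constructor
        · rintro ⟨h, hx, _⟩
          rw [lt_rearrangement_iff hf hx hs, ENNReal.ofReal_lt_iff_lt_toReal hx.le
            (measure_ne_top _ _)] at h
          exact ⟨hx, h⟩
        · rintro ⟨hx, h⟩
          refine ⟨?_, hx, h.trans_le hle⟩
          rw [lt_rearrangement_iff hf hx hs, ENNReal.ofReal_lt_iff_lt_toReal hx.le
            (measure_ne_top _ _)]
          exact h
      rw [h1, Real.volume_Ioo, sub_zero, ofReal_measureReal]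
      rfl
  have hU : (volume.restrict (Set.Ioo 0 (μ.real Set.univ))).map (rearrangement μ f) Set.univ =
      μ.map (fun t => |f t|) Set.univ := by
    rw [Measure.map_apply_of_aemeasurable hm MeasurableSet.univ,
      Measure.map_apply hf.abs MeasurableSet.univ, Set.preimage_univ, Set.preimage_univ,
      Measure.restrict_apply_univ, huniv]
  refine Measure.ext_of_Iic _ _ fun s => ?_
  rw [← Set.compl_Ioi, measure_compl measurableSet_Ioi (measure_ne_top _ _),
    measure_compl measurableSet_Ioi (measure_ne_top _ _), hIoi, hU]

lemma lintegral_comp_rearrangement [IsFiniteMeasure μ] (hf : Measurable f) {φ : ℝ → ℝ≥0∞}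
    (hφ : Measurable φ) :
    ∫⁻ x in Set.Ioo 0 (μ.real Set.univ), φ (rearrangement μ f x) = ∫⁻ t, φ |f t| ∂μ := by
  have hm : AEMeasurable (rearrangement μ f) (volume.restrict (Set.Ioo 0 (μ.real Set.univ))) :=
    aemeasurable_restrict_of_antitoneOn measurableSet_Ioo
      ((antitoneOn_rearrangement hf).mono fun x hx => hx.1)
  rw [← lintegral_map' hφ.aemeasurable hm, map_rearrangement hf, lintegral_map hφ hf.abs]

/-! ### Superexponential tails, exponential integrability and the limit condition. -/

/-- The tails of `|g|` decay faster than every exponential. -/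
def HasSuperexponentialTail (μ : Measure Ω) (g : Ω → ℝ) : Prop :=
  ∀ C : ℝ, 0 < C → ∀ᶠ u : ℝ in atTop, μ.real {t | u ≤ |g t|} < Real.exp (-C * u)

/-- Markov's inequality at the rate C + 1: the spare factor e^{-u} eventually absorbs the constant
value of the integral. -/
lemma hasSuperexponentialTail_of_lintegral [IsFiniteMeasure μ] (hg : Measurable g)
    (h : ∀ a : ℝ, 1 < a → ∫⁻ t, ENNReal.ofReal (a ^ |g t|) ∂μ < ∞) :
    HasSuperexponentialTail μ g := by
  intro C hC
  have hfin := h (Real.exp (C + 1)) (Real.one_lt_exp_iff.2 (by linarith))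
  set I := ∫⁻ t, ENNReal.ofReal (Real.exp (C + 1) ^ |g t|) ∂μ with hI
  have hmarkov : ∀ u : ℝ, Real.exp ((C + 1) * u) * μ.real {t | u ≤ |g t|} ≤ I.toReal := by
    intro u
    have h1 : ENNReal.ofReal (Real.exp ((C + 1) * u)) * μ {t | u ≤ |g t|} ≤ I := by
      refine le_trans ?_ (mul_meas_ge_le_lintegral₀
        (measurable_const.pow hg.abs).ennreal_ofReal.aemeasurable
        (ENNReal.ofReal (Real.exp ((C + 1) * u))))
      gcongr with t
      intro ht
      refine ENNReal.ofReal_le_ofReal ?_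
      rw [← Real.exp_mul]
      exact Real.exp_le_exp.2 (mul_le_mul_of_nonneg_left ht (by linarith))
    have h2 := ENNReal.toReal_mono hfin.ne h1
    rwa [ENNReal.toReal_mul, ENNReal.toReal_ofReal (Real.exp_pos _).le] at h2
  filter_upwards [Real.tendsto_exp_atTop.eventually_gt_atTop I.toReal] with u hu
  have h3 := (hmarkov u).trans_lt hu
  have h4 : Real.exp ((C + 1) * u) = Real.exp u * Real.exp (C * u) := by
    rw [← Real.exp_add]; ring_nf
  rw [h4, mul_assoc] at h3
  have h5 : Real.exp (C * u) * μ.real {t | u ≤ |g t|} < 1 := by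
    by_contra! hcon
    nlinarith [Real.exp_pos u]
  rw [neg_mul, Real.exp_neg, ← one_div, lt_div_iff₀ (Real.exp_pos _), mul_comm]
  exact h5

/-- Slicing along integer levels n of |g|: the value a^{n+1} against a tail of rate log a + 1 leaves
a·e^{-n}, a convergent geometric series. Levels below N contribute a bounded function on a finite
measure space. -/
lemma lintegral_rpow_lt_top_of_hasSuperexponentialTail [IsFiniteMeasure μ] (hg : Measurable g)
    (h : HasSuperexponentialTail μ g) {a : ℝ} (ha : 1 < a) :
    ∫⁻ t, ENNReal.ofReal (a ^ |g t|) ∂μ < ∞ := by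
  have hla : 0 < Real.log a := Real.log_pos ha
  obtain ⟨N, hN⟩ := eventually_atTop.1
    (tendsto_natCast_atTop_atTop.eventually (h (Real.log a + 1) (by linarith)))
  have ha0 : 0 < a := by linarith
  have hbound : ∀ t, ENNReal.ofReal (a ^ |g t|) ≤ ENNReal.ofReal (a ^ (N : ℝ)) +
      ∑' n : ℕ, {t | ((n + N : ℕ) : ℝ) ≤ |g t|}.indicator
        (fun _ => ENNReal.ofReal (a ^ ((n + N : ℕ) + 1 : ℝ))) t := by
    intro t
    rcases le_total |g t| N with hN' | hN'
    · exact le_add_right (ENNReal.ofReal_le_ofReal (Real.rpow_le_rpow_of_exponent_le ha.le hN'))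
    -- Of the whole series only the term at level ⌊|g t|⌋ is needed; its index is shifted by N.
    · refine le_add_left (le_trans ?_ (ENNReal.le_tsum (⌊|g t|⌋₊ - N)))
      have h1 : ⌊|g t|⌋₊ - N + N = ⌊|g t|⌋₊ := Nat.sub_add_cancel (Nat.le_floor hN')
      have hmem : t ∈ {s | (⌊|g t|⌋₊ : ℝ) ≤ |g s|} := Nat.floor_le (abs_nonneg (g t))
      rw [h1, Set.indicator_of_mem hmem]
      exact ENNReal.ofReal_le_ofReal
        (Real.rpow_le_rpow_of_exponent_le ha.le (Nat.lt_floor_add_one _).le)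
  refine (lintegral_mono hbound).trans_lt ?_
  have hms : ∀ n : ℕ, MeasurableSet {t | ((n + N : ℕ) : ℝ) ≤ |g t|} := fun n =>
    measurableSet_le measurable_const hg.abs
  rw [lintegral_add_left measurable_const, lintegral_const,
    lintegral_tsum fun n => (measurable_const.indicator (hms n)).aemeasurable]
  refine ENNReal.add_lt_top.2 ⟨ENNReal.mul_lt_top ENNReal.ofReal_lt_top (measure_lt_top _ _), ?_⟩
  have hterm : ∀ n : ℕ, ∫⁻ t, {t | ((n + N : ℕ) : ℝ) ≤ |g t|}.indicator
        (fun _ => ENNReal.ofReal (a ^ ((n + N : ℕ) + 1 : ℝ))) t ∂μ ≤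
      ENNReal.ofReal (a * Real.exp (-1) ^ n) := by
    intro n
    rw [lintegral_indicator_const (hms n), ← ofReal_measureReal,
      ← ENNReal.ofReal_mul (by positivity)]
    refine ENNReal.ofReal_le_ofReal ?_
    have h1 := (hN (n + N) (by omega)).le
    calc a ^ ((n + N : ℕ) + 1 : ℝ) * μ.real {t | ((n + N : ℕ) : ℝ) ≤ |g t|}
        ≤ a ^ ((n + N : ℕ) + 1 : ℝ) * Real.exp (-(Real.log a + 1) * (n + N : ℕ)) := by gcongr
      _ = a * Real.exp (-(n + N : ℕ)) := by
        rw [Real.rpow_add ha0, Real.rpow_one, Real.rpow_def_of_pos ha0, mul_comm (Real.exp _) a,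
          mul_assoc, ← Real.exp_add]
        ring_nf
      _ ≤ a * Real.exp (-1) ^ n := by
        rw [← Real.exp_nat_mul]
        gcongr
        push_cast
        have : (0 : ℝ) ≤ N := Nat.cast_nonneg N
        linarith
  refine (ENNReal.tsum_le_tsum hterm).trans_lt ?_
  have hs : Summable fun n : ℕ => a * Real.exp (-1) ^ n :=
    (summable_geometric_of_lt_one (Real.exp_pos _).le
      (Real.exp_lt_one_iff.2 (by norm_num))).mul_left a
  rw [← ENNReal.ofReal_tsum_of_nonneg (fun n => by positivity) hs]
  exact ENNReal.ofReal_lt_top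

/-- Up to a null set, {|1/g| > 1/u} is the complement of {|g| ≥ u}. The assumption g ≠ 0 a.e.
excludes the convention 0⁻¹ = 0. -/
lemma lt_rearrangement_inv_iff [IsFiniteMeasure μ] (hg : Measurable g) (hg0 : ∀ᵐ t ∂μ, g t ≠ 0)
    {x u : ℝ} (hx : 0 < x) (hu : 0 < u) :
    u⁻¹ < rearrangement μ (fun t => (g t)⁻¹) x ↔ μ.real {t | u ≤ |g t|} < μ.real Set.univ - x := by
  have hms : MeasurableSet {t | u ≤ |g t|} := measurableSet_le measurable_const hg.abs
  have hset : μ {t | u⁻¹ < |(g t)⁻¹|} = μ {t | u ≤ |g t|}ᶜ := by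
    refine measure_congr ?_
    filter_upwards [hg0] with t ht
    change (u⁻¹ < |(g t)⁻¹|) = (¬ (u ≤ |g t|))
    rw [abs_inv, inv_lt_inv₀ hu (abs_pos.2 ht), not_le]
  rw [lt_rearrangement_iff (f := fun t => (g t)⁻¹) hg.inv hx (by positivity), hset,
    ENNReal.ofReal_lt_iff_lt_toReal hx.le (measure_ne_top _ _)]
  change x < μ.real _ ↔ _
  rw [measureReal_compl hms]
  constructor <;> intro h <;> linarith

lemma hasSuperexponentialTail_iff_tendsto [IsFiniteMeasure μ] (hg : Measurable g)
    (hg0 : ∀ᵐ t ∂μ, g t ≠ 0) :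
    HasSuperexponentialTail μ g ↔
      Tendsto (fun x => (μ.real Set.univ - x) ^ rearrangement μ (fun t => (g t)⁻¹) x)
        (𝓝[Set.Ioo 0 (μ.real Set.univ)] (μ.real Set.univ)) (𝓝 0) := by
  set M := μ.real Set.univ with hM
  constructor
  · intro h
    have hy : Tendsto (fun x => M - x) (𝓝[Set.Ioo 0 M] M) (𝓝[>] 0) := by
      refine tendsto_nhdsWithin_iff.2 ⟨?_, ?_⟩
      · have : Tendsto (fun x => M - x) (𝓝 M) (𝓝 (M - M)) := tendsto_const_nhds.sub tendsto_id
        rw [sub_self] at this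
        exact this.mono_left nhdsWithin_le_nhds
      · filter_upwards [self_mem_nhdsWithin] with x hx
        exact sub_pos.2 hx.2
    refine Metric.tendsto_nhds.2 fun ε hε => ?_
    -- Chosen so that e^{-C} ≤ ε; the cap 1/2 keeps C positive.
    set C : ℝ := Real.log (1 / min ε (1 / 2)) with hC
    have hm0 : 0 < min ε (1 / 2) := by positivity
    have hm1 : min ε (1 / 2) < 1 := (min_le_right _ _).trans_lt (by norm_num)
    have hC0 : 0 < C := Real.log_pos (one_lt_one_div hm0 hm1)
    have heC : Real.exp (-C) ≤ ε := by
      rw [hC, one_div, Real.log_inv, neg_neg, Real.exp_log hm0]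
      exact min_le_left _ _
    -- The level u solves e^{-Cu} = μ(Ω) - x. There the rearrangement exceeds 1/u, and multiplying
    -- by log(μ(Ω) - x) = -Cu < 0 puts the logarithm of the power below -C.
    have hu : Tendsto (fun x => -Real.log (M - x) / C) (𝓝[Set.Ioo 0 M] M) atTop :=
      (tendsto_neg_atBot_atTop.comp (Real.tendsto_log_nhdsGT_zero.comp hy)).atTop_div_const hC0
    filter_upwards [hu.eventually (h C hC0), hu.eventually_gt_atTop 0, self_mem_nhdsWithin]
      with x hx hx0 hxM
    have hpos : 0 < M - x := sub_pos.2 hxM.2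
    have e1 : -C * (-Real.log (M - x) / C) = Real.log (M - x) := by field_simp
    rw [e1, Real.exp_log hpos, ← lt_rearrangement_inv_iff hg hg0 hxM.1 hx0] at hx
    have hlog : Real.log (M - x) < 0 := by
      by_contra! hcon
      exact absurd hx0 (not_lt.2 (div_nonpos_of_nonpos_of_nonneg (by linarith) hC0.le))
    rw [dist_zero_right, Real.norm_eq_abs, abs_of_nonneg (Real.rpow_nonneg hpos.le _),
      Real.rpow_def_of_pos hpos]
    refine lt_of_lt_of_le (Real.exp_lt_exp.2 ?_) heC
    have h2 := mul_lt_mul_of_neg_left hx hlog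
    refine h2.trans_eq ?_
    have := hlog.ne
    field_simp
  · intro h C hC
    -- If μ(Ω) = 0 the filter is trivial and the limit says nothing, but every tail vanishes.
    rcases (measureReal_nonneg (μ := μ) (s := Set.univ)).eq_or_lt with h0 | h0
    · refine .of_forall fun u => lt_of_le_of_lt ?_ (Real.exp_pos _)
      exact h0 ▸ measureReal_mono (Set.subset_univ _)
    have hexp : Tendsto (fun u : ℝ => Real.exp (-C * u)) atTop (𝓝 0) := by
      refine Real.tendsto_exp_atBot.comp ?_
      exact tendsto_id.const_mul_atTop_of_neg (by linarith)
    have hx : Tendsto (fun u : ℝ => M - Real.exp (-C * u)) atTop (𝓝[Set.Ioo 0 M] M) := by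
      refine tendsto_nhdsWithin_iff.2 ⟨by simpa using tendsto_const_nhds.sub hexp, ?_⟩
      filter_upwards [hexp.eventually (gt_mem_nhds h0)] with u hu
      exact ⟨sub_pos.2 hu, sub_lt_self _ (Real.exp_pos _)⟩
    have hev := (h.comp hx).eventually (gt_mem_nhds (Real.exp_pos (-C)))
    filter_upwards [hev, hexp.eventually (gt_mem_nhds h0), eventually_gt_atTop 0] with u hu hu1 hu0
    simp only [Function.comp_apply, sub_sub_cancel] at hu
    rw [← Real.exp_mul, Real.exp_lt_exp] at hu
    -- The bound (e^{-Cu})^r < e^{-C} means exactly ur > 1.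
    have h1 : u⁻¹ < rearrangement μ (fun t => (g t)⁻¹) (M - Real.exp (-C * u)) := by
      rw [inv_lt_iff_one_lt_mul₀ hu0]
      by_contra! hcon
      nlinarith
    have h2 := (lt_rearrangement_inv_iff hg hg0 (sub_pos.2 hu1) hu0).1 h1
    rwa [← hM, sub_sub_cancel] at h2

end Rearrangement

/-! ### A Young-type inequality and the chain from integrability to strict singularity. -/

/-- The threshold y = x^{(p-q)/q} is where the two right-hand terms coincide with the left. Below it
the x-term alone dominates, above it the y-term does, so the constants are 1 whatever the exponents.
-/
lemma Real.mul_rpow_le_rpow_add_rpow {x y p q : ℝ} (hx : 0 ≤ x) (hy : 0 ≤ y) (hq : 0 < q)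
    (hqp : q < p) : (x * y) ^ q ≤ x ^ p + y ^ (p * q / (p - q)) := by
  have hpq : 0 < p - q := sub_pos.2 hqp
  rcases hx.eq_or_lt with rfl | hx0
  · rw [zero_mul, Real.zero_rpow hq.ne', Real.zero_rpow (by linarith), zero_add]
    positivity
  rcases le_total y (x ^ ((p - q) / q)) with h | h
  · calc (x * y) ^ q ≤ (x * x ^ ((p - q) / q)) ^ q := by gcongr
      _ = x ^ p := by
        rw [← Real.rpow_one_add' hx (by positivity), ← Real.rpow_mul hx]
        congr 1
        field_simp
        ring
      _ ≤ _ := le_add_of_nonneg_right (by positivity)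
  · have h1 : x ≤ y ^ (q / (p - q)) := by
      calc x = (x ^ ((p - q) / q)) ^ (q / (p - q)) := by
            rw [← Real.rpow_mul hx, div_mul_div_comm, mul_comm q, div_self (by positivity),
              Real.rpow_one]
        _ ≤ _ := by gcongr
    calc (x * y) ^ q ≤ (y ^ (q / (p - q)) * y) ^ q := by gcongr
      _ = y ^ (p * q / (p - q)) := by
        rw [← Real.rpow_add_one' hy (by positivity), ← Real.rpow_mul hy]
        congr 1
        field_simp
        ring
      _ ≤ _ := le_add_of_nonneg_left (by positivity)

namespace VarLp

variable {Ω : Type*} [MeasurableSpace Ω] {μ : Measure Ω} {p q : Exponent Ω}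

lemma measurable_gap (p q : Exponent Ω) : Measurable fun t => p t * q t / (p t - q t) :=
  (p.measurable'.mul q.measurable').div (p.measurable'.sub q.measurable')

lemma gap_pos {t : Ω} (h : q t < p t) : 0 < p t * q t / (p t - q t) := by
  have hp := p.one_le' t
  have hq := q.one_le' t
  have := sub_pos.2 h
  positivity

/-- Write f/ε = (f/4)(4/ε) and apply the Young-type inequality. The factor f/4 has p-modular at most
1/2; the summand 2 makes the base of the exponential exceed 1 for every ε. -/
lemma modular_indicator_div_le (hqp : ∀ᵐ t ∂μ, q t < p t) {f : Ω → ℝ}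
    (hf : AEStronglyMeasurable f μ) (hf1 : modular μ p (fun t => f t / 2) ≤ 1) {A : Set Ω}
    {ε : ℝ} (hε : 0 < ε) :
    modular μ q (fun t => A.indicator f t / ε) ≤ ENNReal.ofReal (1 / 2) +
      ∫⁻ t, A.indicator (fun t =>
        ENNReal.ofReal ((4 / ε + 2) ^ |p t * q t / (p t - q t)|)) t ∂μ := by
  have h1 : modular μ p (fun t => 1 / 2 * (f t / 2)) ≤ ENNReal.ofReal (1 / 2) :=
    (modular_smul_le (by norm_num) (by norm_num)).trans
      ((mul_le_mul_right hf1 _).trans (mul_one _).le)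
  have hm : AEMeasurable (fun t => ENNReal.ofReal (|1 / 2 * (f t / 2)| ^ p t)) μ :=
    measurable_modular_integrand (f := fun t => 1 / 2 * (f t / 2)) <| by
      have := (hf.const_mul (2 : ℝ)⁻¹).const_mul (1 / 2 : ℝ)
      simpa only [div_eq_inv_mul] using this
  refine le_trans ?_ (add_le_add_left h1 _)
  rw [modular, modular, ← lintegral_add_left' hm]
  refine lintegral_mono_ae ?_
  filter_upwards [hqp] with t ht
  have hp := p.one_le' t
  have hq := q.one_le' t
  by_cases hA : t ∈ A
  · rw [Set.indicator_of_mem hA, Set.indicator_of_mem hA,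
      ← ENNReal.ofReal_add (by positivity) (by positivity), abs_of_pos (gap_pos ht)]
    refine ENNReal.ofReal_le_ofReal ?_
    have e : |f t / ε| = |1 / 2 * (f t / 2)| * (4 / ε) := by
      have h4 : |4 / ε| = 4 / ε := abs_of_pos (by positivity)
      rw [← h4, ← abs_mul]
      congr 1
      ring
    rw [e]
    refine (Real.mul_rpow_le_rpow_add_rpow (abs_nonneg _) (by positivity) (by linarith)
      ht).trans ?_
    have := (gap_pos ht).le
    gcongr
    linarith
  · rw [Set.indicator_of_notMem hA, zero_div, abs_zero, Real.zero_rpow (by linarith),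
      ENNReal.ofReal_zero]
    exact zero_le

/-- Almost every point lies in the support of at most one f_n, so the indicators of the supports
tend to 0; since T creates no new support, T f_n is unchanged by cutting off to the support of f_n.
-/
lemma IsLWeaklyCompact.isMWeaklyCompact {T : VarLp μ p →L[ℝ] VarLp μ q}
    (hT : ∀ f : VarLp μ p, ∀ᵐ t ∂μ, f t = 0 → T f t = 0) (h : IsLWeaklyCompact T) :
    IsMWeaklyCompact T := by
  rintro f ⟨C, hC⟩ hdis
  have hmeas : ∀ n, Measurable (f n : Ω → ℝ) := fun n => AEEqFun.measurable _
  have hms : ∀ n, MeasurableSet {t | f n t ≠ 0} := fun n =>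
    (hmeas n (measurableSet_singleton 0)).compl
  have hlim := h (fun n => {t | f n t ≠ 0}) hms <| by
    have hall : ∀ᵐ t ∂μ, ∀ m n, m ≠ n → f m t = 0 ∨ f n t = 0 := by
      refine ae_all_iff.2 fun m => ae_all_iff.2 fun n => ?_
      by_cases hmn : m = n
      · exact .of_forall fun t h => absurd hmn h
      · filter_upwards [hdis hmn] with t ht _ using ht
    filter_upwards [hall] with t ht
    by_cases hex : ∃ m, f m t ≠ 0
    · obtain ⟨m, hm⟩ := hex
      refine tendsto_const_nhds.congr' ?_
      filter_upwards [eventually_gt_atTop m] with n hn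
      have hmem : t ∉ {t | f n t ≠ 0} := fun hmem => hmem ((ht m n hn.ne).resolve_left hm)
      exact (Set.indicator_of_notMem hmem _).symm
    · push Not at hex
      refine tendsto_const_nhds.congr fun n => ?_
      have hmem : t ∉ {t | f n t ≠ 0} := fun hmem => hmem (hex n)
      exact (Set.indicator_of_notMem hmem _).symm
  -- A positive bound for all the norms, used to scale the f_n into the unit ball.
  set D : ℝ := |C| + 1 with hD
  have hD0 : 0 < D := by positivity
  have hbound : ∀ n, ENNReal.ofReal ‖T (D⁻¹ • f n)‖ ≤ ⨆ g ∈ {g : VarLp μ p | ‖g‖ ≤ 1},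
      ENNReal.ofReal (luxNorm μ q ({t | f n t ≠ 0}.indicator (T g))) := by
    intro n
    have hmem : (D⁻¹ • f n) ∈ {g : VarLp μ p | ‖g‖ ≤ 1} := by
      change ‖D⁻¹ • f n‖ ≤ 1
      rw [norm_smul, norm_inv, Real.norm_of_nonneg hD0.le, inv_mul_le_iff₀ hD0, mul_one]
      exact (hC n).trans ((le_abs_self C).trans (by linarith))
    refine le_trans (le_of_eq ?_) (le_iSup₂ (f := fun (g : VarLp μ p)
      (_ : g ∈ {g : VarLp μ p | ‖g‖ ≤ 1}) =>
        ENNReal.ofReal (luxNorm μ q ({t | f n t ≠ 0}.indicator (T g)))) _ hmem)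
    rw [norm_def]
    congr 1
    refine luxNorm_congr ?_
    have hs : (D⁻¹ • f n : VarLp μ p) =ᵐ[μ] fun t => D⁻¹ * f n t :=
      AEEqFun.coeFn_smul D⁻¹ (f n : Ω →ₘ[μ] ℝ)
    filter_upwards [hT (D⁻¹ • f n), hs] with t ht hst
    by_cases h0 : f n t = 0
    · rw [Set.indicator_of_notMem (show t ∉ {t | f n t ≠ 0} from fun hmem => hmem h0)]
      exact ht (by rw [hst, h0, mul_zero])
    · rw [Set.indicator_of_mem (show t ∈ {t | f n t ≠ 0} from h0)]
  have h1 : Tendsto (fun n => ENNReal.ofReal ‖T (D⁻¹ • f n)‖) atTop (𝓝 0) :=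
    tendsto_of_tendsto_of_tendsto_of_le_of_le tendsto_const_nhds hlim (fun _ => zero_le) hbound
  have h2 := (ENNReal.tendsto_toReal ENNReal.zero_ne_top).comp h1
  have h3 := h2.const_mul D
  rw [ENNReal.toReal_zero, mul_zero] at h3
  refine h3.congr fun n => ?_
  rw [Function.comp_apply, ENNReal.toReal_ofReal (norm_nonneg _), map_smul, norm_smul, norm_inv,
    Real.norm_of_nonneg hD0.le, mul_inv_cancel_left₀ hD0.ne']

lemma IsMWeaklyCompact.isDSS {F : Type*} [NormedAddCommGroup F] [NormedSpace ℝ F]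
    {T : VarLp μ p →L[ℝ] F} (h : IsMWeaklyCompact T) : IsDSS T := by
  rintro f hf hdis ⟨c, hc, hiso⟩
  have hlim := h f ⟨1, fun n => (hf n).le⟩ hdis
  refine absurd (ge_of_tendsto' hlim fun n => ?_) (not_le.2 hc)
  have := hiso (f n) (Submodule.le_topologicalClosure _ (Submodule.subset_span ⟨n, rfl⟩))
  rwa [hf n, mul_one] at this

variable [IsFiniteMeasure μ]

/-- The modular bound depends on A only through ∫_A a^g dμ, which tends to 0 along A_n by dominated
convergence with majorant a^g. -/
lemma isLWeaklyCompact_inclusion (hqp : ∀ᵐ t ∂μ, q t < p t)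
    (h : ∀ a : ℝ, 1 < a → ∫⁻ t, ENNReal.ofReal (a ^ |p t * q t / (p t - q t)|) ∂μ < ∞) :
    IsLWeaklyCompact (inclusion (hqp.mono fun _ h => h.le)) := by
  intro A hA hlim
  refine ENNReal.tendsto_nhds_zero.2 fun ε' hε' => ?_
  obtain ⟨ε, hε, hεε'⟩ : ∃ ε : ℝ, 0 < ε ∧ ENNReal.ofReal ε ≤ ε' := by
    obtain ⟨r, hr, hr'⟩ := ENNReal.lt_iff_exists_nnreal_btwn.1 hε'
    exact ⟨r, by exact_mod_cast hr, by rw [ENNReal.ofReal_coe_nnreal]; exact hr'.le⟩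
  set G : Ω → ℝ≥0∞ := fun t => ENNReal.ofReal ((4 / ε + 2) ^ |p t * q t / (p t - q t)|) with hG
  have hGm : Measurable G := (measurable_const.pow (measurable_gap p q).abs).ennreal_ofReal
  have ha : 1 < 4 / ε + 2 := by
    have : 0 < 4 / ε := by positivity
    linarith
  have ht : Tendsto (fun n => ∫⁻ t, (A n).indicator G t ∂μ) atTop (𝓝 (∫⁻ _, 0 ∂μ)) := by
    refine tendsto_lintegral_of_dominated_convergence G (fun n => hGm.indicator (hA n))
      (fun n => .of_forall fun t => Set.indicator_le_self _ _ _) (h _ ha).ne ?_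
    filter_upwards [hlim] with t ht
    refine tendsto_const_nhds.congr' ?_
    filter_upwards [ht.eventually (gt_mem_nhds one_pos)] with n hn
    by_cases hmem : t ∈ A n
    · rw [Set.indicator_of_mem hmem] at hn
      exact absurd hn (lt_irrefl _)
    · rw [Set.indicator_of_notMem hmem]
  rw [lintegral_zero] at ht
  have hhalf : (0 : ℝ≥0∞) < ENNReal.ofReal (1 / 2) := ENNReal.ofReal_pos.2 (by norm_num)
  filter_upwards [ht.eventually (gt_mem_nhds hhalf)] with n hn
  refine iSup₂_le fun f hf => le_trans (ENNReal.ofReal_le_ofReal (luxNorm_le hε ?_)) hεε'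
  have hfn : ‖f‖ ≤ 1 := hf
  -- Any divisor above 1 would do: a norm at most 1 controls the modular only after dividing by a
  -- number strictly larger than the norm.
  have hf1 : modular μ p (fun t => f t / 2) ≤ 1 :=
    (modular_le_one_of_luxNorm_lt (exists_le_one f)
      (lt_of_le_of_lt hfn (by norm_num : (1 : ℝ) < 2))).2
  refine (modular_indicator_div_le hqp (AEEqFun.aestronglyMeasurable (f : Ω →ₘ[μ] ℝ)) hf1
    hε).trans ?_
  calc _ ≤ ENNReal.ofReal (1 / 2) + ENNReal.ofReal (1 / 2) := by gcongr
    _ = 1 := by rw [← ENNReal.ofReal_add (by norm_num) (by norm_num)]; norm_num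

/-! ### Normalized indicators and their closed span. -/

lemma coeFn_normalizedIndicator (E : Set Ω) (hE : MeasurableSet E) :
    normalizedIndicator (μ := μ) p E hE =ᵐ[μ] E.indicator fun t => 1 / μ.real E ^ (1 / p t) :=
  AEEqFun.coeFn_mk _ _

lemma one_div_rpow_one_div_rpow {m : ℝ} (hm : 0 ≤ m) {s : ℝ} (hs : 1 ≤ s) :
    (1 / m ^ (1 / s)) ^ s = m⁻¹ := by
  rw [one_div, Real.inv_rpow (by positivity), ← Real.rpow_mul hm,
    one_div_mul_cancel (by linarith), Real.rpow_one]

lemma modular_normalizedIndicator {E : Set Ω} (hE : MeasurableSet E) (h0 : 0 < μ E) :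
    modular μ p (normalizedIndicator (μ := μ) p E hE) = 1 := by
  rw [modular_congr (coeFn_normalizedIndicator E hE), modular]
  have h : ∀ t, ENNReal.ofReal (|E.indicator (fun t => 1 / μ.real E ^ (1 / p t)) t| ^ p t) =
      E.indicator (fun _ => (μ E)⁻¹) t := by
    intro t
    have hp := p.one_le' t
    have hE0 : 0 ≤ μ.real E := measureReal_nonneg
    by_cases ht : t ∈ E
    · rw [Set.indicator_of_mem ht, Set.indicator_of_mem ht, abs_of_nonneg (by positivity),
        one_div_rpow_one_div_rpow hE0 hp, ENNReal.ofReal_inv_of_pos (x := μ.real E)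
          (ENNReal.toReal_pos h0.ne' (measure_ne_top _ _)), ofReal_measureReal]
    · rw [Set.indicator_of_notMem ht, Set.indicator_of_notMem ht, abs_zero,
        Real.zero_rpow (by linarith), ENNReal.ofReal_zero]
  simp only [h]
  rw [lintegral_indicator_const hE, ENNReal.inv_mul_cancel h0.ne' (measure_ne_top _ _)]

/-- A norm below r < 1 would give ρ(f) ≤ r·ρ(f/r) ≤ r < 1, against ρ(f) = 1. -/
lemma norm_normalizedIndicator {E : Set Ω} (hE : MeasurableSet E) (h0 : 0 < μ E) :
    ‖normalizedIndicator (μ := μ) p E hE‖ = 1 := by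
  have h1 := modular_normalizedIndicator (p := p) hE h0
  refine le_antisymm (luxNorm_le one_pos (by simp only [div_one]; exact h1.le)) ?_
  by_contra! hlt
  obtain ⟨r, hr, hr1⟩ := exists_between hlt
  obtain ⟨hr0, hr2⟩ := modular_le_one_of_luxNorm_lt (exists_le_one _) hr
  have h2 := modular_smul_le (μ := μ) (p := p)
    (f := fun t => normalizedIndicator (μ := μ) p E hE t / r) hr0.le hr1.le
  have e : (fun t => r * (normalizedIndicator (μ := μ) p E hE t / r)) =
      normalizedIndicator (μ := μ) p E hE := by
    funext t
    field_simp
  rw [e, h1] at h2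
  have h3 : ENNReal.ofReal r * modular μ p
      (fun t => normalizedIndicator (μ := μ) p E hE t / r) ≤ ENNReal.ofReal r * 1 := by gcongr
  rw [mul_one] at h3
  exact absurd (h2.trans h3) (not_le.2 (ENNReal.ofReal_lt_one.2 hr1))

lemma isDisjointSeq_normalizedIndicator {E : ℕ → Set Ω} (hE : ∀ n, MeasurableSet (E n))
    (hd : Pairwise fun m n => Disjoint (E m) (E n)) :
    IsDisjointSeq fun n => normalizedIndicator (μ := μ) p (E n) (hE n) := by
  intro m n hmn
  filter_upwards [coeFn_normalizedIndicator (μ := μ) (p := p) (E m) (hE m),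
    coeFn_normalizedIndicator (μ := μ) (p := p) (E n) (hE n)] with t h1 h2
  by_cases ht : t ∈ E m
  · right
    rw [h2, Set.indicator_of_notMem (Set.disjoint_left.1 (hd hmn) ht)]
  · left
    rw [h1, Set.indicator_of_notMem ht]

/-- Elements of the span of the normalized indicators are multiples of `1 / μ(E_n)^{1/p(·)}` on
each `E_n` and vanish off `⋃ E_n`. -/
lemma exists_coeff_of_mem_span {E : ℕ → Set Ω} (hE : ∀ n, MeasurableSet (E n))
    (hd : Pairwise fun m n => Disjoint (E m) (E n)) {f : VarLp μ p}
    (hf : f ∈ Submodule.span ℝ (Set.range fun n => normalizedIndicator (μ := μ) p (E n) (hE n))) :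
    ∃ a : ℕ → ℝ, ∀ᵐ t ∂μ, (∀ n, t ∈ E n → f t = a n * (1 / μ.real (E n) ^ (1 / p t))) ∧
      ((∀ n, t ∉ E n) → f t = 0) := by
  induction hf using Submodule.span_induction with
  | mem f hf =>
    obtain ⟨m, rfl⟩ := hf
    refine ⟨fun n => if n = m then 1 else 0, ?_⟩
    filter_upwards [coeFn_normalizedIndicator (μ := μ) (p := p) (E m) (hE m)] with t ht
    simp only [ht]
    refine ⟨fun n hn => ?_, fun h => Set.indicator_of_notMem (h m) _⟩
    by_cases hnm : n = m
    · subst hnm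
      rw [Set.indicator_of_mem hn, if_pos rfl, one_mul]
    · rw [Set.indicator_of_notMem (Set.disjoint_left.1 (hd hnm) hn), if_neg hnm, zero_mul]
  | zero =>
    refine ⟨fun _ => 0, ?_⟩
    filter_upwards [AEEqFun.coeFn_zero (α := Ω) (β := ℝ) (μ := μ)] with t ht
    have h0 : (0 : VarLp μ p) t = 0 := ht
    exact ⟨fun n _ => by rw [h0, zero_mul], fun _ => h0⟩
  | add f g _ _ hf hg =>
    obtain ⟨a, ha⟩ := hf
    obtain ⟨b, hb⟩ := hg
    refine ⟨fun n => a n + b n, ?_⟩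
    have hfg : (f + g : VarLp μ p) =ᵐ[μ] fun t => f t + g t :=
      AEEqFun.coeFn_add (f : Ω →ₘ[μ] ℝ) (g : Ω →ₘ[μ] ℝ)
    filter_upwards [ha, hb, hfg] with t h1 h2 h3
    rw [h3]
    exact ⟨fun n hn => by rw [h1.1 n hn, h2.1 n hn]; ring,
      fun h => by rw [h1.2 h, h2.2 h, add_zero]⟩
  | smul c f _ hf =>
    obtain ⟨a, ha⟩ := hf
    refine ⟨fun n => c * a n, ?_⟩
    have hcf : (c • f : VarLp μ p) =ᵐ[μ] fun t => c * f t :=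
      AEEqFun.coeFn_smul c (f : Ω →ₘ[μ] ℝ)
    filter_upwards [ha, hcf] with t h1 h3
    rw [h3]
    exact ⟨fun n hn => by rw [h1.1 n hn, mul_assoc], fun h => by rw [h1.2 h, mul_zero]⟩

/-- If `μ(E) ≥ K^{-pq/(p-q)}` at a point, then `K χ_E / μ(E)^{1/p}` dominates `χ_E / μ(E)^{1/q}`
there. -/
lemma inv_le_mul_rpow {m K P Q : ℝ} (hm : 0 < m) (hK : 1 ≤ K) (hQ : 1 ≤ Q) (hQP : Q < P)
    (h : K ^ (-(P * Q / (P - Q))) ≤ m) : m⁻¹ ≤ (K * (1 / m ^ (1 / P))) ^ Q := by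
  have hPQ : 0 < P - Q := sub_pos.2 hQP
  have hP : 0 < P := by linarith
  have hQ0 : 0 < Q := by linarith
  have hK0 : 0 < K := by linarith
  have h1 : K ^ (-Q) ≤ m ^ ((P - Q) / P) := by
    calc K ^ (-Q) = (K ^ (-(P * Q / (P - Q)))) ^ ((P - Q) / P) := by
          rw [← Real.rpow_mul hK0.le]
          congr 1
          field_simp
      _ ≤ _ := by gcongr
  have h2 : (K * (1 / m ^ (1 / P))) ^ Q = K ^ Q * m ^ (-(Q / P)) := by
    rw [Real.mul_rpow hK0.le (by positivity), one_div, Real.inv_rpow (by positivity),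
      ← Real.rpow_mul hm.le, ← Real.rpow_neg hm.le]
    congr 2
    ring
  have h3 : m⁻¹ = m ^ (-(Q / P)) * m ^ (-((P - Q) / P)) := by
    rw [← Real.rpow_add hm, ← Real.rpow_neg_one]
    congr 1
    field_simp
    ring
  rw [h2, h3, mul_comm (K ^ Q)]
  gcongr
  rw [Real.rpow_neg hm.le]
  rw [Real.rpow_neg hK0.le] at h1
  exact inv_le_of_inv_le₀ (by positivity) h1

/-- On E_n the ratio of the q- to the p-normalized indicator is at most K. After scaling so that
ρ_q(f/r) ≤ 1, all coefficients b_n are at most 1, hence b_n^p ≤ b_n^q and ρ_p(f/(Kr)) ≤ ρ_q(f/r). -/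
lemma isIsomorphismOn_closedSpan_normalizedIndicator (hqp : ∀ᵐ t ∂μ, q t < p t) {E : ℕ → Set Ω}
    (hE : ∀ n, MeasurableSet (E n)) (h0 : ∀ n, 0 < μ (E n))
    (hd : Pairwise fun m n => Disjoint (E m) (E n)) {K : ℝ} (hK : 1 ≤ K)
    (hKE : ∀ n, ∀ᵐ t ∂μ, t ∈ E n → K ^ (-(p t * q t / (p t - q t))) ≤ μ.real (E n)) :
    IsIsomorphismOn (inclusion (hqp.mono fun _ h => h.le))
      (closedSpan fun n => normalizedIndicator (μ := μ) p (E n) (hE n)) := by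
  have hK0 : 0 < K := by linarith
  set T : VarLp μ p →L[ℝ] VarLp μ q := inclusion (hqp.mono fun _ h => h.le) with hT
  refine ⟨K⁻¹, by positivity, ?_⟩
  -- The lower bound is a closed condition, so it suffices to check it on the algebraic span.
  have hclosed : IsClosed {f : VarLp μ p | K⁻¹ * ‖f‖ ≤ ‖T f‖} :=
    isClosed_le (continuous_const.mul continuous_norm) T.continuous.norm
  refine fun f hf => closure_minimal (fun f hf => ?_) hclosed hf
  obtain ⟨a, ha⟩ := exists_coeff_of_mem_span hE hd hf
  change K⁻¹ * ‖f‖ ≤ ‖T f‖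
  rw [inv_mul_le_iff₀ hK0]
  refine le_of_forall_pos_le_add fun ε hε => ?_
  obtain ⟨hr, hmod⟩ := modular_le_one_of_luxNorm_lt (exists_le_one (T f))
    (show luxNorm μ q (T f) < ‖T f‖ + ε / K by
      rw [norm_def]; exact lt_add_of_pos_right _ (by positivity))
  set r := ‖T f‖ + ε / K with hrdef
  have hKr : K * ‖T f‖ + ε = K * r := by rw [hrdef]; field_simp
  rw [hKr]
  have hm : ∀ n, 0 < μ.real (E n) := fun n => ENNReal.toReal_pos (h0 n).ne' (measure_ne_top _ _)
  set b : ℕ → ℝ := fun n => |a n| / (K * r) with hb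
  have hb0 : ∀ n, 0 ≤ b n := fun n => by positivity
  have hKE' := ae_all_iff.2 hKE
  have hq_lower : ∀ᵐ t ∂μ, ∀ n, t ∈ E n →
      b n ^ q t * (μ.real (E n))⁻¹ ≤ |f t / r| ^ q t := by
    filter_upwards [ha, hKE', hqp] with t h1 h2 h3 n hn
    have hq := q.one_le' t
    have hmn := hm n
    have e : |f t / r| = b n * (K * (1 / μ.real (E n) ^ (1 / p t))) := by
      rw [h1.1 n hn, abs_div, abs_mul, abs_of_pos hr,
        abs_of_pos (show 0 < 1 / μ.real (E n) ^ (1 / p t) by positivity), hb]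
      field_simp
    rw [e, Real.mul_rpow (hb0 n) (by positivity)]
    exact mul_le_mul_of_nonneg_left (inv_le_mul_rpow hmn hK hq h3 (h2 n hn))
      (Real.rpow_nonneg (hb0 n) _)
  -- A coefficient above 1 would make the q-modular on the single set E_n exceed 1, because b ≤ b^q
  -- for b ≥ 1.
  have hb1 : ∀ n, b n ≤ 1 := by
    intro n
    by_contra! hlt
    have h1 : ENNReal.ofReal (b n) ≤ modular μ q (fun t => T f t / r) := by
      calc ENNReal.ofReal (b n)
          = ∫⁻ t, (E n).indicator (fun _ => ENNReal.ofReal (b n * (μ.real (E n))⁻¹)) t ∂μ := by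
            rw [lintegral_indicator_const (hE n), ← ofReal_measureReal,
              ← ENNReal.ofReal_mul (mul_nonneg (hb0 n) (inv_nonneg.2 (hm n).le)),
              inv_mul_cancel_right₀ (hm n).ne']
        _ ≤ _ := by
          refine lintegral_mono_ae ?_
          filter_upwards [hq_lower] with t ht
          by_cases hn : t ∈ E n
          · rw [Set.indicator_of_mem hn]
            refine ENNReal.ofReal_le_ofReal (le_trans ?_ (ht n hn))
            refine mul_le_mul_of_nonneg_right ?_ (inv_nonneg.2 (hm n).le)
            exact Real.self_le_rpow_of_one_le hlt.le (q.one_le' t)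
          · rw [Set.indicator_of_notMem hn]
            exact zero_le
    have h2 := h1.trans hmod
    rw [ENNReal.ofReal_le_one] at h2
    linarith
  refine luxNorm_le (by positivity) (le_trans ?_ hmod)
  refine lintegral_mono_ae ?_
  filter_upwards [ha, hq_lower, hqp] with t h1 h2 h3
  refine ENNReal.ofReal_le_ofReal ?_
  have hq := q.one_le' t
  have hp := p.one_le' t
  change |f t / (K * r)| ^ p t ≤ |f t / r| ^ q t
  by_cases hex : ∃ n, t ∈ E n
  · obtain ⟨n, hn⟩ := hex
    refine le_trans ?_ (h2 n hn)
    have hmn := hm n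
    have e : |f t / (K * r)| = b n * (1 / μ.real (E n) ^ (1 / p t)) := by
      rw [h1.1 n hn, abs_div, abs_mul, abs_of_pos (show 0 < K * r by positivity),
        abs_of_pos (show 0 < 1 / μ.real (E n) ^ (1 / p t) by positivity), hb]
      field_simp
    rw [e, Real.mul_rpow (hb0 n) (by positivity), one_div_rpow_one_div_rpow hmn.le hp]
    refine mul_le_mul_of_nonneg_right ?_ (inv_nonneg.2 hmn.le)
    exact Real.rpow_le_rpow_of_exponent_ge_of_imp (hb0 n) (hb1 n) h3.le
      (fun _ hq0 => absurd hq0 (by linarith))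
  · push Not at hex
    rw [h1.2 hex, zero_div, zero_div, abs_zero, Real.zero_rpow (by linarith),
      Real.zero_rpow (by linarith)]

/-! ### Level bands of exponentially large measure. -/

/-- If the tail of `|g|` is not superexponentially small, there are disjoint level bands of `|g|`
of exponentially large measure. -/
lemma exists_disjoint_of_not_hasSuperexponentialTail {g : Ω → ℝ} (hg : Measurable g)
    (h : ¬ HasSuperexponentialTail μ g) :
    ∃ C : ℝ, 0 < C ∧ ∃ E : ℕ → Set Ω, (∀ n, MeasurableSet (E n)) ∧ (∀ n, 0 < μ (E n)) ∧
      (Pairwise fun m n => Disjoint (E m) (E n)) ∧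
      ∀ n, ∀ t ∈ E n, Real.exp (-C * |g t|) ≤ μ.real (E n) := by
  unfold HasSuperexponentialTail at h
  push Not at h
  obtain ⟨C, hC, hfreq⟩ := h
  have hfreq : ∃ᶠ u : ℝ in atTop, Real.exp (-C * u) ≤ μ.real {t | u ≤ |g t|} := by
    simpa only [not_eventually, not_lt] using hfreq
  have hms : ∀ u : ℝ, MeasurableSet {t | u ≤ |g t|} := fun u =>
    measurableSet_le measurable_const hg.abs
  have hanti : Antitone fun u : ℝ => {t | u ≤ |g t|} := by
    intro u v huv t ht
    simp only [Set.mem_ofPred_eq] at ht ⊢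
    exact huv.trans ht
  have hlim : Tendsto (fun u : ℝ => μ.real {t | u ≤ |g t|}) atTop (𝓝 0) := by
    have h1 := tendsto_measure_iInter_atTop (μ := μ) (s := fun u : ℝ => {t | u ≤ |g t|})
      (fun u => (hms u).nullMeasurableSet) hanti ⟨0, measure_ne_top _ _⟩
    have h2 : (⋂ u : ℝ, {t | u ≤ |g t|}) = ∅ := by
      ext t
      simp only [Set.mem_iInter, Set.mem_ofPred_eq, Set.mem_empty_iff_false, iff_false, not_forall,
        not_le]
      exact exists_gt _
    rw [h2, measure_empty] at h1
    exact (ENNReal.tendsto_toReal ENNReal.zero_ne_top).comp h1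
  -- Each new level has a large tail itself, yet a tail less than half of the previous exponential;
  -- the band between consecutive levels therefore keeps at least half.
  have hstep : ∀ u : ℝ, ∃ v : ℝ, u ≤ v ∧ 1 ≤ v ∧ Real.exp (-C * v) ≤ μ.real {t | v ≤ |g t|} ∧
      μ.real {t | v ≤ |g t|} < Real.exp (-C * u) / 2 := by
    intro u
    obtain ⟨v, h1, h2, h3, h4⟩ := (hfreq.and_eventually ((eventually_ge_atTop u).and
      ((eventually_ge_atTop 1).and (hlim.eventually
        (gt_mem_nhds (half_pos (Real.exp_pos (-C * u)))))))).exists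
    exact ⟨v, h2, h3, h1, h4⟩
  choose next hge hone hlow hhigh using hstep
  -- Starting at `next 0` rather than 0 puts every level in the range of `next`, so each one is at
  -- least 1 and has a large tail.
  set w : ℕ → ℝ := fun n => next^[n + 1] 0 with hw
  have hwsucc : ∀ n, w (n + 1) = next (w n) := fun n => Function.iterate_succ_apply' _ _ _
  have hwnext : ∀ n, ∃ u, w n = next u := fun n =>
    ⟨next^[n] 0, Function.iterate_succ_apply' _ _ _⟩
  have hwmono : Monotone w := monotone_nat_of_le_succ fun n => by
    rw [hwsucc]; exact hge _
  set E : ℕ → Set Ω := fun n => {t | w n ≤ |g t|} \ {t | w (n + 1) ≤ |g t|} with hEdef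
  have hmeasure : ∀ n, Real.exp (-C * w n) / 2 ≤ μ.real (E n) := by
    intro n
    have h1 : Real.exp (-C * w n) ≤ μ.real {t | w n ≤ |g t|} := by
      obtain ⟨u, hu⟩ := hwnext n
      rw [hu]; exact hlow u
    have h2 : μ.real {t | w (n + 1) ≤ |g t|} < Real.exp (-C * w n) / 2 := by
      rw [hwsucc]; exact hhigh _
    have h3 : μ.real (E n) = μ.real {t | w n ≤ |g t|} - μ.real {t | w (n + 1) ≤ |g t|} :=
      measureReal_sdiff (hanti (hwmono n.le_succ)) (hms _)
    linarith
  -- Raising the rate by 1 absorbs the factor 1/2, since e^{-|g|} ≤ e^{-1} ≤ 1/2 on bands where |g|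
  -- ≥ 1.
  refine ⟨C + 1, by linarith, E, fun n => (hms _).diff (hms _), fun n => ?_, ?_, ?_⟩
  · have h1 : 0 < μ.real (E n) := lt_of_lt_of_le (by positivity) (hmeasure n)
    exact (ENNReal.toReal_pos_iff.1 h1).1
  · have key : ∀ m n, m < n → Disjoint (E m) (E n) := by
      intro m n hmn
      refine Set.disjoint_left.2 fun t htm htn => htm.2 ?_
      exact hanti (hwmono (Nat.succ_le_of_lt hmn)) htn.1
    intro m n hmn
    rcases lt_or_gt_of_ne hmn with h | h
    · exact key m n h
    · exact (key n m h).symm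
  · intro n t ht
    have h1 : w n ≤ |g t| := ht.1
    have h2 : 1 ≤ w n := by
      obtain ⟨u, hu⟩ := hwnext n
      rw [hu]; exact hone u
    refine le_trans ?_ (hmeasure n)
    have h3 : (2 : ℝ) ≤ Real.exp 1 := by
      have := Real.add_one_le_exp (1 : ℝ)
      linarith
    rw [le_div_iff₀ two_pos]
    calc Real.exp (-(C + 1) * |g t|) * 2 ≤ Real.exp (-(C + 1) * |g t|) * Real.exp 1 := by gcongr
      _ = Real.exp (-(C + 1) * |g t| + 1) := (Real.exp_add _ _).symm
      _ ≤ Real.exp (-C * w n) := by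
        refine Real.exp_le_exp.2 ?_
        nlinarith

/-- If the tail condition fails, the bands satisfy the comparability hypothesis with K = e^C, and
their normalized indicators span a subspace on which the inclusion is an isomorphism. -/
lemma hasSuperexponentialTail_of_not_isIsomorphismOn (hqp : ∀ᵐ t ∂μ, q t < p t)
    (h : ∀ (E : ℕ → Set Ω) (hE : ∀ n, MeasurableSet (E n)), (∀ n, 0 < μ (E n)) →
      Pairwise (fun m n => Disjoint (E m) (E n)) →
      ¬ IsIsomorphismOn (inclusion (hqp.mono fun _ h => h.le))
        (closedSpan fun n => normalizedIndicator (μ := μ) p (E n) (hE n))) :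
    HasSuperexponentialTail μ fun t => p t * q t / (p t - q t) := by
  by_contra hcon
  obtain ⟨C, hC, E, hE, h0, hd, hexp⟩ :=
    exists_disjoint_of_not_hasSuperexponentialTail (measurable_gap p q) hcon
  refine h E hE h0 hd (isIsomorphismOn_closedSpan_normalizedIndicator hqp hE h0 hd
    (Real.one_le_exp hC.le) fun n => ?_)
  filter_upwards [hqp] with t ht hn
  have h1 := hexp n t hn
  rw [abs_of_pos (gap_pos ht)] at h1
  rw [← Real.exp_mul]
  refine le_of_eq_of_le ?_ h1
  congr 1
  ring

end VarLp

/-! ### The cycle of implications. -/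

theorem theorem4p8 {Ω : Type*} [MeasurableSpace Ω] (μ : Measure Ω) [IsFiniteMeasure μ]
    (hμ : IsAtomless μ) (p q : Exponent Ω) (hqp : ∀ᵐ t ∂μ, q t < p t) :
    List.TFAE [
      ∀ a : ℝ, 1 < a → ∫⁻ x in Set.Ioo 0 (μ.real Set.univ),
        ENNReal.ofReal (a ^ rearrangement μ (fun t => p t * q t / (p t - q t)) x) < ∞,
      VarLp.IsLWeaklyCompact (VarLp.inclusion (hqp.mono fun _ h => h.le)),
      VarLp.IsMWeaklyCompact (VarLp.inclusion (hqp.mono fun _ h => h.le)),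
      VarLp.IsDSS (VarLp.inclusion (hqp.mono fun _ h => h.le)),
      ∀ (E : ℕ → Set Ω) (hE : ∀ n, MeasurableSet (E n)), (∀ n, 0 < μ (E n)) →
        Pairwise (fun m n => Disjoint (E m) (E n)) →
        ¬ VarLp.IsIsomorphismOn (VarLp.inclusion (hqp.mono fun _ h => h.le))
          (VarLp.closedSpan fun n => VarLp.normalizedIndicator (μ := μ) p (E n) (hE n)),
      Tendsto (fun x => (μ.real Set.univ - x) ^
          rearrangement μ (fun t => (p t - q t) / (p t * q t)) x)
        (𝓝[Set.Ioo 0 (μ.real Set.univ)] (μ.real Set.univ)) (𝓝 0)] := by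
  have hg := VarLp.measurable_gap p q
  have hint : ∀ a : ℝ, ∫⁻ x in Set.Ioo 0 (μ.real Set.univ),
      ENNReal.ofReal (a ^ rearrangement μ (fun t => p t * q t / (p t - q t)) x) =
      ∫⁻ t, ENNReal.ofReal (a ^ |p t * q t / (p t - q t)|) ∂μ := fun a =>
    lintegral_comp_rearrangement (φ := fun s => ENNReal.ofReal (a ^ s)) hg
      (measurable_const.pow measurable_id).ennreal_ofReal
  have htail := hasSuperexponentialTail_iff_tendsto hg
    (hqp.mono fun t ht => (VarLp.gap_pos ht).ne')
  -- Identifies 1/g with (p-q)/(pq), so that the last condition can be replaced by the tail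
  -- condition.
  simp only [inv_div] at htail
  rw [← htail]
  simp only [hint]
  tfae_have 1 → 2 := VarLp.isLWeaklyCompact_inclusion hqp
  tfae_have 2 → 3 := fun h => h.isMWeaklyCompact fun f => .of_forall fun t ht => ht
  tfae_have 3 → 4 := fun h => h.isDSS
  tfae_have 4 → 5 := fun h E hE h0 hd => h _
    (fun n => VarLp.norm_normalizedIndicator (hE n) (h0 n))
    (VarLp.isDisjointSeq_normalizedIndicator hE hd)
  tfae_have 5 → 6 := VarLp.hasSuperexponentialTail_of_not_isIsomorphismOn hqp
  tfae_have 6 → 1 := fun h a ha => lintegral_rpow_lt_top_of_hasSuperexponentialTail hg h ha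
  tfae_finish
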